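/- Let $h>0$ and $\mathbb{H}_h=\{\omega\in\mathbb{C}:\operatorname{Im}\omega>-h\}$, and let $H(\mathbb{H}_h)$ be the space of analytic functions on $\mathbb{H}_h$ with the topology of uniform convergence on compact subsets of $\mathbb{H}_h$. Let $\mathcal{K}_h\subset H(\mathbb{H}_h)$ be the set of all analytic $f:\mathbb{H}_h\to\mathbb{C}$ such that (S) $\overline{f(\omega)}=f(-\overline{\omega})$ for all $\omega\in\mathbb{H}_h$; (P) $\operatorname{Im}f(\omega)>0$ whenever $\operatorname{Im}\omega>-h$ and $\operatorname{Re}\omega>0$; (L) for some $A>0$, $f(\omega)=-A\omega^{-2}+O(\omega^{-3})$ as $\omega\to\infty$ in $\mathbb{H}_h$. Let $\mathcal{S}_h$ be the closure of $\mathcal{K}_h$ in $H(\mathbb{H}_h)$. Theorem. For every complex-valued $f_{\rm exp}\in L^2(0,1)$ the least squares problem $$\mathfrak{E}(f_{\rm exp})=\min_{f\in\mathcal{S}_h}\|f-f_{\rm exp}\|_{L^2(0,1)}$$ has a unique solution: the minimum is attained (and finite), and by exactly one $f\in\mathcal{S}_h$. Moreover $\mathcal{K}_h$ is non-empty and $$\inf_{f\in\mathcal{K}_h}\|f-f_{\rm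 exp}\|_{L^2(0,1)}=\mathfrak{E}(f_{\rm exp}).$$ -/

import Mathlib

open Set Filter Topology MeasureTheory Asymptotics Bornology
open scoped ENNReal ComplexConjugate

noncomputable section

namespace Permittivity

/-- The half-plane `{ω ∈ ℂ : Im ω > -h}`. -/
def halfPlane (h : ℝ) : Set ℂ := {ω : ℂ | -h < ω.im}

/-- Extension by zero to `ℂ` of a function on the half-plane. It is only ever evaluated,
or differentiated, at points of the (open) half-plane. -/
def extZero {h : ℝ} (f : halfPlane h → ℂ) : ℂ → ℂ :=
  Function.extend Subtype.val f 0

theorem extZero_apply {h : ℝ} (f : halfPlane h → ℂ) (ω : halfPlane h) :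
    extZero f (ω : ℂ) = f ω :=
  Subtype.val_injective.extend_apply f 0 ω

/-- The space of analytic functions on the half-plane `{Im ω > -h}`. As a subspace of
`C(halfPlane h, ℂ)` with the compact-open topology, it carries the topology of uniform
convergence on compact subsets of the half-plane. -/
def Hol (h : ℝ) : Submodule ℂ C(halfPlane h, ℂ) where
  carrier := {f | DifferentiableOn ℂ (extZero f) (halfPlane h)}
  add_mem' := by
    intro f g hf hg
    refine (DifferentiableOn.add hf hg).congr fun ω hω => ?_
    have e := fun u : halfPlane h → ℂ => extZero_apply u ⟨ω, hω⟩
    simp only at e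
    simp [e]
  zero_mem' := by
    refine (differentiableOn_const (0 : ℂ)).congr fun ω hω => ?_
    have e := fun u : halfPlane h → ℂ => extZero_apply u ⟨ω, hω⟩
    simp only at e
    simp [e]
  smul_mem' := by
    intro c f hf
    refine (DifferentiableOn.const_smul hf c).congr fun ω hω => ?_
    have e := fun u : halfPlane h → ℂ => extZero_apply u ⟨ω, hω⟩
    simp only at e
    simp [e]

/-- The value of an analytic function on the half-plane at a complex number
(zero outside the half-plane). -/
def value {h : ℝ} (f : Hol h) : ℂ → ℂ := extZero (f : C(halfPlane h, ℂ))

/-- The class of physically admissible complex permittivity functions: analytic functions on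
`{Im ω > -h}` with the symmetry, passivity and plasma limit properties. -/
def physClass (h : ℝ) : Set (Hol h) :=
  {f | (∀ ω ∈ halfPlane h, conj (value f ω) = value f (-conj ω)) ∧
       (∀ ω ∈ halfPlane h, 0 < ω.re → 0 < (value f ω).im) ∧
       ∃ A : ℝ, 0 < A ∧
         (fun ω : ℂ => value f ω + (A : ℂ) / ω ^ 2)
           =O[cobounded ℂ ⊓ 𝓟 (halfPlane h)] fun ω : ℂ => (ω ^ 3)⁻¹}

/-- The closure of the physical class in the space of analytic functions on the half-plane. -/
def closedClass (h : ℝ) : Set (Hol h) := closure (physClass h)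

/-- The `L²(0,1)` distance (in `[0, ∞]`) between `f` and the data `fexp`. -/
def misfit {h : ℝ} (fexp : ℝ → ℂ) (f : Hol h) : ℝ≥0∞ :=
  eLpNorm (fun x : ℝ => value f (x : ℂ) - fexp x) 2 (volume.restrict (Ioo (0 : ℝ) 1))

end Permittivity

end

namespace Permittivity

open Metric

/-! The crux is that a bound in $L^2(0,1)$ controls elements of $\mathcal{S}_h$ locally uniformly.
Functions in $\mathcal{K}_h$ omit $(-\infty,0]$ (`value_mem_slitPlane`), so their principal square
roots have positive real part. Harnack's inequality (`norm_le_of_re_pos`), squared, compares $|f|$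
at any two points with a constant independent of $f$, and this passes to the closure
(`norm_value_le`).

Comparing with the points of $(0,1)$ bounds $|f(\omega)|$ by the $L^2$ norm. By Montel, norm-bounded
closed parts of $\mathcal{S}_h$ are compact, so the continuous misfit attains its minimum.
Uniqueness combines midpoint convexity, the parallelogram law and the identity theorem. The infimum
over $\mathcal{K}_h$ agrees by density and continuity. -/

theorem isOpen_halfPlane (h : ℝ) : IsOpen (halfPlane h) :=
  isOpen_lt continuous_const Complex.continuous_im

theorem convex_halfPlane (h : ℝ) : Convex ℝ (halfPlane h) :=
  convex_halfSpace_im_gt (-h)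

theorem ofReal_mem_halfPlane {h : ℝ} (hh : 0 < h) (x : ℝ) : (x : ℂ) ∈ halfPlane h := by
  simpa [halfPlane] using hh

theorem value_coe {h : ℝ} (f : Hol h) (ω : halfPlane h) :
    value f (ω : ℂ) = (f : C(halfPlane h, ℂ)) ω :=
  extZero_apply _ ω

theorem differentiableOn_value {h : ℝ} (f : Hol h) :
    DifferentiableOn ℂ (value f) (halfPlane h) := f.2

theorem value_add {h : ℝ} (f g : Hol h) {ω : ℂ} (hω : ω ∈ halfPlane h) :
    value (f + g) ω = value f ω + value g ω := by
  lift ω to halfPlane h using hω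
  simp [value_coe]

theorem value_smul {h : ℝ} (c : ℂ) (f : Hol h) {ω : ℂ} (hω : ω ∈ halfPlane h) :
    value (c • f) ω = c * value f ω := by
  lift ω to halfPlane h using hω
  simp [value_coe]

/-- A holomorphic function on the half-plane as an element of `Hol h`. -/
def ofDifferentiableOn {h : ℝ} (F : ℂ → ℂ) (hF : DifferentiableOn ℂ F (halfPlane h)) : Hol h :=
  ⟨⟨(halfPlane h).domRestrict F, hF.continuousOn.domRestrict⟩, hF.congr fun ω hω =>
    extZero_apply ((halfPlane h).domRestrict F) ⟨ω, hω⟩⟩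

theorem value_ofDifferentiableOn {h : ℝ} (F : ℂ → ℂ) (hF : DifferentiableOn ℂ F (halfPlane h))
    {ω : ℂ} (hω : ω ∈ halfPlane h) : value (ofDifferentiableOn F hF) ω = F ω := by
  lift ω to halfPlane h using hω
  exact value_coe _ ω

theorem continuous_value {h : ℝ} (ω : ℂ) : Continuous fun f : Hol h => value f ω := by
  by_cases hω : ω ∈ halfPlane h
  · lift ω to halfPlane h using hω
    simp only [value_coe]
    exact (continuous_eval_const ω).comp continuous_subtype_val
  · have : ∀ f : Hol h, value f ω = 0 := fun f =>
      Function.extend_apply' _ _ _ fun ⟨a, ha⟩ => hω (ha ▸ a.2)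
    simpa only [this] using continuous_const

/-- The witness $-(\omega+ih)^{-2}$ has its pole on the boundary line. For
$\operatorname{Re}\omega>0$ the shifted point lies in the open first quadrant, hence its square in
the upper half-plane. -/
theorem physClass_nonempty {h : ℝ} (hh : 0 < h) :
    (physClass h).Nonempty := by
  have hne : ∀ ω ∈ halfPlane h, ω + h * Complex.I ≠ 0 := fun ω hω h0 => by
    have := congrArg Complex.im h0
    simp [halfPlane] at this hω
    linarith
  have hd : DifferentiableOn ℂ (fun ω : ℂ => -((ω + h * Complex.I) ^ 2)⁻¹) (halfPlane h) :=
    DifferentiableOn.neg (DifferentiableOn.inv (by fun_prop) fun ω hω => pow_ne_zero 2 (hne ω hω))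
  refine ⟨ofDifferentiableOn _ hd, fun ω hω => ?_, fun ω hω hre => ?_, 1, one_pos, ?_⟩
  · have hω' : -conj ω ∈ halfPlane h := by simpa [halfPlane] using hω
    rw [value_ofDifferentiableOn _ _ hω, value_ofDifferentiableOn _ _ hω']
    simp only [map_neg, map_inv₀, map_pow, map_add, map_mul, Complex.conj_ofReal, Complex.conj_I]
    congr 2
    ring
  · rw [value_ofDifferentiableOn _ _ hω]
    simp only [halfPlane, mem_ofPred_eq] at hω
    rw [Complex.neg_im, Complex.inv_im, neg_div, neg_neg]
    refine div_pos ?_ (Complex.normSq_pos.2 (pow_ne_zero 2 (hne ω hω)))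
    simp only [pow_two, Complex.mul_im, Complex.add_re, Complex.add_im, Complex.mul_re,
      Complex.ofReal_re, Complex.ofReal_im, Complex.I_re, Complex.I_im]
    have : 0 < ω.im + h := by linarith
    nlinarith [mul_pos hre this]
  -- For $|\omega|\ge 2h$ the numerator is at most $4h|\omega|$ and the denominator at least
  -- $|\omega|^4/4$.
  · refine IsBigO.of_bound (16 * h) ?_
    have hlarge : ∀ᶠ ω : ℂ in cobounded ℂ, 2 * h ≤ ‖ω‖ :=
      tendsto_norm_cobounded_atTop.eventually_ge_atTop _
    filter_upwards [hlarge.filter_mono inf_le_left, mem_inf_of_right (mem_principal_self _)]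
      with ω hl hω
    rw [value_ofDifferentiableOn _ _ hω]
    have hz := hne ω hω
    have hnω : 0 < ‖ω‖ := by linarith
    have hω0 : ω ≠ 0 := norm_pos_iff.1 hnω
    have e : -((ω + h * Complex.I) ^ 2)⁻¹ + ((1 : ℝ) : ℂ) / ω ^ 2
        = (2 * ω + h * Complex.I) * (h * Complex.I) / (ω ^ 2 * (ω + h * Complex.I) ^ 2) := by
      field_simp
      push_cast
      ring
    have hn : ‖(h : ℂ) * Complex.I‖ = h := by simp [abs_of_pos hh]
    have h1 : ‖ω‖ / 2 ≤ ‖ω + h * Complex.I‖ := by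
      have := norm_sub_le_norm_add ω (h * Complex.I)
      rw [hn] at this
      linarith
    have h2 : ‖2 * ω + h * Complex.I‖ ≤ 4 * ‖ω‖ := by
      refine (norm_add_le _ _).trans ?_
      rw [hn, norm_mul]
      norm_num
      linarith
    rw [e, norm_div, norm_mul _ ((h : ℂ) * Complex.I), norm_mul (ω ^ 2), hn, norm_pow, norm_pow,
      norm_inv, norm_pow]
    calc ‖2 * ω + h * Complex.I‖ * h / (‖ω‖ ^ 2 * ‖ω + h * Complex.I‖ ^ 2)
        ≤ 4 * ‖ω‖ * h / (‖ω‖ ^ 2 * (‖ω‖ / 2) ^ 2) := by gcongr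
      _ = 16 * h * (‖ω‖ ^ 3)⁻¹ := by field_simp; norm_num

/-! ### Values avoid the closed negative real axis -/

theorem value_im_eq_zero {h : ℝ} {f : Hol h} (hf : f ∈ physClass h) {y : ℝ} (hy : -h < y) :
    (value f (y * Complex.I)).im = 0 := by
  have := hf.1 (y * Complex.I) (by simpa [halfPlane] using hy)
  simp only [map_mul, Complex.conj_ofReal, Complex.conj_I, mul_neg, neg_neg] at this
  exact Complex.conj_eq_iff_im.1 this

/-- $\operatorname{Im}f$ vanishes on the imaginary axis and is positive to its right. -/
theorem im_deriv_value_nonneg {h : ℝ} {f : Hol h} (hf : f ∈ physClass h) {y : ℝ} (hy : -h < y) :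
    0 ≤ (deriv (value f) (y * Complex.I)).im := by
  have hmem : (y * Complex.I : ℂ) ∈ halfPlane h := by simpa [halfPlane] using hy
  have hd := ((differentiableOn_value f).differentiableAt
    ((isOpen_halfPlane h).mem_nhds hmem)).hasDerivAt
  have h1 : HasDerivAt (fun x : ℝ => value f (y * Complex.I + x))
      (deriv (value f) (y * Complex.I)) 0 := by
    have : HasDerivAt (fun x : ℝ => (y * Complex.I + x : ℂ)) 1 0 := by
      simpa using (Complex.ofRealCLM.hasDerivAt (x := 0)).const_add (y * Complex.I : ℂ)
    have hd' : HasDerivAt (value f) (deriv (value f) (y * Complex.I))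
      (y * Complex.I + ((0 : ℝ) : ℂ)) := by simpa using hd
    simpa using! hd'.comp (0 : ℝ) this
  have h2 : HasDerivAt (fun x : ℝ => (value f (y * Complex.I + x)).im)
      (deriv (value f) (y * Complex.I)).im 0 := by
    simpa using! Complex.imCLM.hasFDerivAt.comp_hasDerivAt (0 : ℝ) h1
  refine ge_of_tendsto h2.tendsto_slope_zero_right ?_
  filter_upwards [self_mem_nhdsWithin] with x hx
  have hx : 0 < x := hx
  simp only [zero_add, Complex.ofReal_zero, add_zero, value_im_eq_zero hf hy, sub_zero, smul_eq_mul]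
  refine mul_nonneg (by positivity) (hf.2.1 _ ?_ ?_).le
  · simpa [halfPlane] using hy
  · simpa using hx

/-- By Cauchy–Riemann, $\frac{d}{dy}\operatorname{Re}f(iy)=-\operatorname{Im}f'(iy)\le 0$. -/
theorem antitoneOn_value_re {h : ℝ} {f : Hol h} (hf : f ∈ physClass h) :
    AntitoneOn (fun y : ℝ => (value f (y * Complex.I)).re) (Ioi (-h)) := by
  have key : ∀ y : ℝ, -h < y → HasDerivAt (fun y : ℝ => (value f (y * Complex.I)).re)
      (-(deriv (value f) (y * Complex.I)).im) y := by
    intro y hy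
    have hmem : (y * Complex.I : ℂ) ∈ halfPlane h := by simpa [halfPlane] using hy
    have hd := ((differentiableOn_value f).differentiableAt
      ((isOpen_halfPlane h).mem_nhds hmem)).hasDerivAt
    have h0 : HasDerivAt (fun x : ℝ => (x * Complex.I : ℂ)) Complex.I y := by
      simpa using (Complex.ofRealCLM.hasDerivAt (x := y)).mul_const Complex.I
    simpa using! Complex.reCLM.hasFDerivAt.comp_hasDerivAt y (hd.comp y h0)
  refine antitoneOn_of_deriv_nonpos (convex_Ioi _)
    (fun y hy => (key y hy).continuousAt.continuousWithinAt)
    (fun y hy => (key y (by simpa using hy)).differentiableAt.differentiableWithinAt)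
    fun y hy => ?_
  have hy : -h < y := by simpa using hy
  rw [(key y hy).deriv]
  exact neg_nonpos.2 (im_deriv_value_nonneg hf hy)

/-- Since $(iy)^2=-y^2$, (L) reads $f(iy)=A/y^2+O(y^{-3})$. -/
theorem eventually_value_re_pos {h : ℝ} {f : Hol h} (hf : f ∈ physClass h) :
    ∀ᶠ y : ℝ in atTop, 0 < (value f (y * Complex.I)).re := by
  obtain ⟨-, -, A, hA, hO⟩ := hf
  obtain ⟨C, hC⟩ := hO.bound
  have ht : Tendsto (fun y : ℝ => (y * Complex.I : ℂ)) atTop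
      (cobounded ℂ ⊓ 𝓟 (halfPlane h)) := by
    refine tendsto_inf.2 ⟨?_, tendsto_principal.2 ?_⟩
    · rw [← tendsto_norm_atTop_iff_cobounded]
      simpa using tendsto_abs_atTop_atTop
    · filter_upwards [eventually_gt_atTop (-h)] with y hy
      simpa [halfPlane] using hy
  filter_upwards [ht.eventually hC, eventually_gt_atTop 0, eventually_gt_atTop (C / A)]
    with y hy hy0 hyC
  have e : (y * Complex.I : ℂ) ^ 2 = ((-y ^ 2 : ℝ) : ℂ) := by
    rw [mul_pow, Complex.I_sq]; push_cast; ring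
  have h1 := (abs_le.1 ((Complex.abs_re_le_norm _).trans hy)).1
  rw [e, ← Complex.ofReal_div, Complex.add_re, Complex.ofReal_re, norm_inv, norm_pow, norm_mul,
    Complex.norm_I, mul_one, Complex.norm_real, Real.norm_of_nonneg hy0.le, div_neg] at h1
  have h2 : C * (y ^ 3)⁻¹ < A / y ^ 2 := by
    rw [← div_eq_mul_inv, div_lt_div_iff₀ (by positivity) (by positivity)]
    rw [div_lt_iff₀ hA] at hyC
    nlinarith [pow_pos hy0 2]
  linarith

/-- Physical permittivity functions avoid the closed negative real axis. -/
theorem value_mem_slitPlane {h : ℝ} {f : Hol h} (hf : f ∈ physClass h) {ω : ℂ}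
    (hω : ω ∈ halfPlane h) : value f ω ∈ Complex.slitPlane := by
  rcases lt_trichotomy ω.re 0 with hre | hre | hre
  · right
    have h1 := hf.2.1 (-conj ω) (by simpa [halfPlane] using hω) (by simpa using hre)
    rw [← hf.1 ω hω, Complex.conj_im] at h1
    linarith
  · left
    have hω' : -h < ω.im := hω
    -- Positivity far up the imaginary axis propagates down by monotonicity.
    obtain ⟨y, hy, hy'⟩ :=
      ((eventually_value_re_pos hf).and (eventually_ge_atTop ω.im)).exists
    have e : ω = ω.im * Complex.I := by
      apply Complex.ext <;> simp [hre]
    rw [e]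
    exact hy.trans_le (antitoneOn_value_re hf hω' (hω'.trans_le hy') hy')
  · exact Or.inr (hf.2.1 ω hω hre).ne'

end Permittivity

/-! ### Harnack's inequality and Montel's theorem -/

namespace Permittivity

open Metric

/-- Harnack's inequality for functions of positive real part on the half-plane. -/
theorem norm_le_of_re_pos {h : ℝ} {F : ℂ → ℂ} (hF : DifferentiableOn ℂ F (halfPlane h))
    (hre : ∀ ω ∈ halfPlane h, 0 < (F ω).re) {z w : ℂ} (hz : z ∈ halfPlane h)
    (hw : w ∈ halfPlane h) :
    ‖F z‖ ≤ ‖z - conj w + 2 * h * Complex.I‖ ^ 2 / ((z.im + h) * (w.im + h)) * ‖F w‖ := by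
  have hz' : 0 < z.im + h := by have : -h < z.im := hz; linarith
  have hw' : 0 < w.im + h := by have : -h < w.im := hw; linarith
  -- The reflection of $w$ in the line $\operatorname{Im}=-h$; the Möbius map `φ` below sends the
  -- disc into the half-plane and $0$ to $w$.
  set w' : ℂ := conj w - 2 * h * Complex.I with hw'def
  have hw're : w'.re = w.re := by simp [hw'def]
  have hw'im : w'.im = -w.im - 2 * h := by simp [hw'def]
  have hzw : z - conj w + 2 * h * Complex.I = z - w' := by rw [hw'def]; ring
  have hzw0 : z - w' ≠ 0 := fun h0 => by
    have := congrArg Complex.im h0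
    rw [Complex.sub_im, hw'im, Complex.zero_im] at this
    linarith
  have hww0 : w - w' ≠ 0 := fun h0 => by
    have := congrArg Complex.im h0
    rw [Complex.sub_im, hw'im, Complex.zero_im] at this
    linarith
  set φ : ℂ → ℂ := fun u => (w - w' * u) / (1 - u) with hφ
  have hu1 : ∀ u ∈ ball (0 : ℂ) 1, (1 : ℂ) - u ≠ 0 := fun u hu h0 => by
    rw [← sub_eq_zero.1 h0] at hu
    simp at hu
  have hφmem : MapsTo φ (ball 0 1) (halfPlane h) := fun u hu => by
    have hpos : 0 < Complex.normSq (1 - u) := Complex.normSq_pos.2 (hu1 u hu)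
    have hu2 : u.re ^ 2 + u.im ^ 2 < 1 := by
      have h1 : ‖u‖ < 1 := by simpa using hu
      have := Complex.sq_norm u
      rw [Complex.normSq_apply] at this
      nlinarith [norm_nonneg u]
    have e : (φ u).im + h
        = (w.im + h) * (1 - (u.re ^ 2 + u.im ^ 2)) / Complex.normSq (1 - u) := by
      rw [hφ, Complex.div_im]
      field_simp
      rw [Complex.normSq_apply]
      simp only [Complex.sub_re, Complex.sub_im, Complex.mul_re, Complex.mul_im, hw're, hw'im,
        Complex.one_re, Complex.one_im]
      ring
    have : 0 < (φ u).im + h := e ▸ div_pos (mul_pos hw' (by linarith)) hpos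
    change -h < (φ u).im
    linarith
  have hφd : DifferentiableOn ℂ φ (ball 0 1) :=
    DifferentiableOn.div (by fun_prop) (by fun_prop) hu1
  have hφ0 : φ 0 = w := by simp [hφ]
  set b := F w
  have hb : 0 < b.re := hre w hw
  have hden : ∀ a : ℂ, 0 < a.re → a + conj b ≠ 0 := fun a ha h0 => by
    have := congrArg Complex.re h0
    simp at this
    linarith
  have hquot : ∀ a : ℂ, 0 < a.re → ‖a - b‖ ≤ ‖a + conj b‖ := fun a ha => by
    refine (sq_le_sq₀ (norm_nonneg _) (norm_nonneg _)).1 ?_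
    rw [Complex.sq_norm, Complex.sq_norm, Complex.normSq_apply, Complex.normSq_apply]
    simp only [Complex.sub_re, Complex.sub_im, Complex.add_re, Complex.add_im, Complex.conj_re,
      Complex.conj_im]
    nlinarith [mul_pos ha hb]
  -- Schwarz's lemma applies to $F\circ\varphi$ followed by the Cayley transform vanishing at $b$.
  have hFφ : DifferentiableOn ℂ (fun u => F (φ u)) (ball 0 1) := hF.comp hφd hφmem
  have hG : DifferentiableOn ℂ (fun u => (F (φ u) - b) / (F (φ u) + conj b)) (ball 0 1) :=
    (hFφ.sub_const b).div (hFφ.add_const _) fun u hu => hden _ (hre _ (hφmem hu))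
  have hGmaps : MapsTo (fun u => (F (φ u) - b) / (F (φ u) + conj b)) (ball 0 1)
      (closedBall 0 1) := fun u hu => by
    rw [mem_closedBall_zero_iff, norm_div]
    exact div_le_one_of_le₀ (hquot _ (hre _ (hφmem hu))) (norm_nonneg _)
  set u := (z - w) / (z - w') with hu
  have hzw_sq : ‖z - w'‖ ^ 2 - ‖z - w‖ ^ 2 = 4 * ((z.im + h) * (w.im + h)) := by
    rw [Complex.sq_norm, Complex.sq_norm, Complex.normSq_apply, Complex.normSq_apply]
    simp only [Complex.sub_re, Complex.sub_im, hw're, hw'im]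
    ring
  have hP := mul_pos hz' hw'
  have hn1 : 0 < ‖z - w'‖ := norm_pos_iff.2 hzw0
  have hlt : ‖z - w‖ < ‖z - w'‖ :=
    lt_of_pow_lt_pow_left₀ 2 (norm_nonneg _) (by linarith)
  have hunorm : ‖u‖ < 1 := by rwa [hu, norm_div, div_lt_one hn1]
  have hφu : φ u = z := by
    have hu' : u * (z - w') = z - w := div_mul_cancel₀ _ hzw0
    simp only [hφ]
    rw [div_eq_iff (hu1 u (by simpa using hunorm))]
    linear_combination hu'
  have hS := Complex.norm_le_norm_of_mapsTo_ball hG hGmaps (by simp [hφ0, b]) hunorm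
  simp only [hφu] at hS
  have haz := hre z hz
  rw [norm_div, hu, norm_div, div_le_div_iff₀ (norm_pos_iff.2 (hden _ haz)) hn1] at hS
  have hs1 : ‖F z‖ - ‖b‖ ≤ ‖F z - b‖ := norm_sub_norm_le _ _
  have hs2 : ‖F z + conj b‖ ≤ ‖F z‖ + ‖b‖ := (norm_add_le _ _).trans_eq (by simp)
  have hs3 : (‖F z‖ - ‖b‖) * ‖z - w'‖ ≤ ‖z - w‖ * (‖F z‖ + ‖b‖) :=
    (mul_le_mul_of_nonneg_right hs1 hn1.le).trans
      (hS.trans (mul_le_mul_of_nonneg_left hs2 (norm_nonneg _)))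
  rw [hzw, div_mul_eq_mul_div, le_div_iff₀ hP]
  -- With $s=|z-w'|$, $t=|z-w|$: multiply by $s+t$, then use `hzw_sq` for $s^2-t^2$ and $(s+t)^2\le
  -- 4s^2$.
  have hs4 : ‖F z‖ * (‖z - w'‖ - ‖z - w‖) ≤ ‖b‖ * (‖z - w'‖ + ‖z - w‖) := by linarith
  have hs5 : ‖b‖ * (‖z - w'‖ + ‖z - w‖) ^ 2 ≤ ‖b‖ * (4 * ‖z - w'‖ ^ 2) := by
    refine mul_le_mul_of_nonneg_left ?_ (norm_nonneg _)
    nlinarith [norm_nonneg (z - w)]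
  have hs6 := mul_le_mul_of_nonneg_right hs4 (add_nonneg hn1.le (norm_nonneg (z - w)))
  have hs7 : ‖F z‖ * (‖z - w'‖ - ‖z - w‖) * (‖z - w'‖ + ‖z - w‖)
      = 4 * (‖F z‖ * ((z.im + h) * (w.im + h))) := by
    linear_combination ‖F z‖ * hzw_sq
  nlinarith

/-- Harnack's inequality for the closed class: the values at two points are comparable. -/
theorem norm_value_le {h : ℝ} {f : Hol h} (hf : f ∈ closedClass h) {z w : ℂ}
    (hz : z ∈ halfPlane h) (hw : w ∈ halfPlane h) :
    ‖value f z‖ ≤ (‖z - conj w + 2 * h * Complex.I‖ ^ 2 / ((z.im + h) * (w.im + h))) ^ 2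
      * ‖value f w‖ := by
  set C := ‖z - conj w + 2 * h * Complex.I‖ ^ 2 / ((z.im + h) * (w.im + h))
  have hclosed : IsClosed {f : Hol h | ‖value f z‖ ≤ C ^ 2 * ‖value f w‖} :=
    isClosed_le (continuous_value z).norm (continuous_const.mul (continuous_value w).norm)
  refine closure_minimal (fun f hf => ?_) hclosed hf
  have hsl : ∀ ω ∈ halfPlane h, value f ω ∈ Complex.slitPlane :=
    fun ω hω => value_mem_slitPlane hf hω
  have hsq : ∀ ω, (value f ω ^ (2⁻¹ : ℂ)) ^ 2 = value f ω := fun ω => by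
    simpa only [Nat.cast_ofNat] using Complex.cpow_nat_inv_pow (value f ω) two_ne_zero
  have hd : DifferentiableOn ℂ (fun ω => value f ω ^ (2⁻¹ : ℂ)) (halfPlane h) :=
    (differentiableOn_value f).cpow_const hsl
  -- Off the slit the argument lies in $(-\pi,\pi)$, and the square root halves it.
  have hre : ∀ ω ∈ halfPlane h, 0 < (value f ω ^ (2⁻¹ : ℂ)).re := fun ω hω => by
    have h0 := Complex.slitPlane_ne_zero (hsl ω hω)
    rw [Complex.cpow_def_of_ne_zero h0, Complex.exp_re]
    refine mul_pos (Real.exp_pos _) (Real.cos_pos_of_mem_Ioo ?_)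
    have e : (Complex.log (value f ω) * 2⁻¹).im = (value f ω).arg / 2 := by
      rw [show (2⁻¹ : ℂ) = ((2⁻¹ : ℝ) : ℂ) by simp, Complex.im_mul_ofReal, Complex.log_im]
      ring
    have h1 := Complex.neg_pi_lt_arg (value f ω)
    have h2 := (Complex.arg_le_pi (value f ω)).lt_of_ne
      (Complex.mem_slitPlane_iff_arg.1 (hsl ω hω)).1
    rw [e]
    constructor <;> linarith
  have key := norm_le_of_re_pos hd hre hz hw
  have := pow_le_pow_left₀ (norm_nonneg _) key 2
  rwa [mul_pow, ← norm_pow, ← norm_pow (value f w ^ _), hsq, hsq] at this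

/-- Weierstrass: locally uniform limits of holomorphic functions are holomorphic. -/
theorem isClosed_Hol (h : ℝ) : IsClosed (Hol h : Set C(halfPlane h, ℂ)) := by
  have : LocallyCompactSpace (halfPlane h) := (isOpen_halfPlane h).locallyCompactSpace
  refine isClosed_iff_clusterPt.2 fun f hf => ?_
  have hne : (𝓝 f ⊓ 𝓟 (Hol h : Set C(halfPlane h, ℂ))).NeBot := hf
  have ht : Tendsto id (𝓝 f ⊓ 𝓟 (Hol h : Set C(halfPlane h, ℂ))) (𝓝 f) := inf_le_left
  rw [ContinuousMap.tendsto_iff_tendstoLocallyUniformly] at ht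
  refine TendstoLocallyUniformlyOn.differentiableOn
    (F := fun g : C(halfPlane h, ℂ) => extZero g)
    (φ := 𝓝 f ⊓ 𝓟 (Hol h : Set C(halfPlane h, ℂ))) ?_
    (mem_inf_of_right fun g hg => hg) (isOpen_halfPlane h)
  rw [tendstoLocallyUniformlyOn_iff_tendstoLocallyUniformly_comp_coe]
  convert ht using 2
  · ext x; exact extZero_apply _ x
  · ext x; exact extZero_apply _ x

/-- **Montel's theorem**: a closed locally bounded family of analytic functions is compact. -/
theorem isCompact_of_locally_bounded {h : ℝ} {S : Set (Hol h)} (hS : IsClosed S) {B : ℂ → ℝ}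
    (hB : ContinuousOn B (halfPlane h))
    (hSB : ∀ f ∈ S, ∀ ω ∈ halfPlane h, ‖value f ω‖ ≤ B ω) : IsCompact S := by
  have : LocallyCompactSpace (halfPlane h) := (isOpen_halfPlane h).locallyCompactSpace
  rw [← hS.closure_eq]
  have : T2Space (UniformOnFun (halfPlane h) ℂ {K | IsCompact K}) :=
    UniformOnFun.t2Space_of_covering (eq_univ_of_forall fun x =>
      mem_sUnion_of_mem (mem_singleton x) isCompact_singleton)
  have hcover : IsClosedEmbedding (UniformOnFun.ofFun {K : Set (halfPlane h) | IsCompact K} ∘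
      fun f : Hol h => ((f : C(halfPlane h, ℂ)) : halfPlane h → ℂ)) :=
    (ContinuousMap.isUniformEmbedding_toUniformOnFunIsCompact.isClosedEmbedding).comp
      (isClosed_Hol h).isClosedEmbedding_subtypeVal
  refine ArzelaAscoli.isCompact_closure_of_isClosedEmbedding (fun K hK => hK) hcover
    (fun K _ => Equicontinuous.equicontinuousOn (fun c => ?_) K) fun K _ ω _ =>
      ⟨closedBall 0 (B ω), isCompact_closedBall _ _, fun f hf => by
        simpa [value_coe] using hSB f hf ω ω.2⟩
  obtain ⟨M, hM⟩ : ∃ M, ∀ᶠ ω in 𝓝 (c : ℂ), B ω ≤ M :=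
    ⟨B c + 1, ((hB.continuousAt ((isOpen_halfPlane h).mem_nhds c.2)).eventually_le_const
      (lt_add_one _))⟩
  obtain ⟨r, hr, hrM⟩ := Metric.eventually_nhds_iff_ball.1
    (hM.and ((isOpen_halfPlane h).mem_nhds c.2))
  -- A common bound $M$ on the ball keeps values within $2M$ of the central one; Schwarz's lemma
  -- then gives equicontinuity for Arzelà–Ascoli.
  have hlip : ∀ f ∈ S, ∀ z ∈ ball (c : ℂ) r,
      dist (value f z) (value f c) ≤ 2 * M / r * dist z c := fun f hf z hz => by
    refine Complex.dist_le_div_mul_dist_of_mapsTo_ball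
      ((differentiableOn_value f).mono fun w hw => (hrM w hw).2) (fun w hw => ?_) hz
    have h1 := (hSB f hf w (hrM w hw).2).trans (hrM w hw).1
    have h2 := (hSB f hf c c.2).trans (hrM c (mem_ball_self hr)).1
    rw [mem_closedBall, dist_eq_norm]
    linarith [norm_sub_le (value f w) (value f c)]
  refine Metric.equicontinuousAt_of_continuity_modulus
    (fun z : halfPlane h => 2 * M / r * dist (z : ℂ) c) ?_ _ ?_
  · have : Continuous fun z : halfPlane h => 2 * M / r * dist (z : ℂ) c := by fun_prop
    simpa using this.tendsto c
  · filter_upwards [continuous_subtype_val.continuousAt.preimage_mem_nhds (ball_mem_nhds (c : ℂ) hr)]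
      with z hz f
    rw [dist_comm]
    simpa [value_coe] using hlip f f.2 z hz

end Permittivity

/-! ### Restriction to $L^2(0,1)$ and compactness -/

namespace Permittivity

open Metric

variable {h : ℝ}

theorem memLp_value (hh : 0 < h) (f : Hol h) :
    MemLp (fun x : ℝ => value f x) 2 (volume.restrict (Ioo (0 : ℝ) 1)) := by
  have hc : Continuous fun x : ℝ => value f x :=
    (differentiableOn_value f).continuousOn.comp_continuous Complex.continuous_ofReal
      (ofReal_mem_halfPlane hh)
  obtain ⟨C, hC⟩ := isCompact_Icc.exists_bound_of_continuousOn (s := Icc (0 : ℝ) 1) hc.continuousOn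
  refine MemLp.of_bound hc.aestronglyMeasurable C ?_
  filter_upwards [ae_restrict_mem measurableSet_Ioo] with x hx
  exact hC x (Ioo_subset_Icc_self hx)

/-- The restriction of an analytic function on the half-plane to `(0,1)`, as an element of `L²`. -/
noncomputable def restrictLp (hh : 0 < h) (f : Hol h) : Lp ℂ 2 (volume.restrict (Ioo (0 : ℝ) 1)) :=
  (memLp_value hh f).toLp _

theorem restrictLp_add (hh : 0 < h) (f g : Hol h) :
    restrictLp hh (f + g) = restrictLp hh f + restrictLp hh g := by
  rw [restrictLp, restrictLp, restrictLp, ← MemLp.toLp_add]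
  congr 1
  ext x
  exact value_add f g (ofReal_mem_halfPlane hh x)

theorem restrictLp_smul (hh : 0 < h) (c : ℂ) (f : Hol h) :
    restrictLp hh (c • f) = c • restrictLp hh f := by
  rw [restrictLp, restrictLp, ← MemLp.toLp_const_smul]
  congr 1
  ext x
  exact value_smul c f (ofReal_mem_halfPlane hh x)

theorem misfit_eq_enorm (hh : 0 < h) {fexp : ℝ → ℂ}
    (hfexp : MemLp fexp 2 (volume.restrict (Ioo (0 : ℝ) 1))) (f : Hol h) :
    misfit fexp f = ‖restrictLp hh f - hfexp.toLp fexp‖ₑ := by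
  rw [restrictLp, ← MemLp.toLp_sub, Lp.enorm_toLp]
  rfl

/-- The interval has measure one, so the sup norm on $[0,1]$ dominates the $L^2$ norm. -/
theorem continuous_restrictLp (hh : 0 < h) : Continuous (restrictLp hh) := by
  let ι : C(Icc (0 : ℝ) 1, halfPlane h) :=
    ⟨fun x => ⟨((x : ℝ) : ℂ), ofReal_mem_halfPlane hh x⟩, by fun_prop⟩
  have hι : Continuous fun f : Hol h => (f : C(halfPlane h, ℂ)).comp ι :=
    (ContinuousMap.continuous_precomp ι).comp continuous_subtype_val
  refine continuous_iff_continuousAt.2 fun f => ?_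
  refine tendsto_iff_norm_sub_tendsto_zero.2 ?_
  have h0 := tendsto_iff_norm_sub_tendsto_zero.1 (hι.tendsto f)
  refine squeeze_zero (fun _ => norm_nonneg _) (fun g => ?_) h0
  rw [restrictLp, restrictLp, ← MemLp.toLp_sub, Lp.norm_toLp]
  refine ENNReal.toReal_le_of_le_ofReal (norm_nonneg _) ?_
  refine (eLpNorm_le_of_ae_bound (C := ‖(g : C(halfPlane h, ℂ)).comp ι
    - (f : C(halfPlane h, ℂ)).comp ι‖) ?_).trans (by simp)
  filter_upwards [ae_restrict_mem measurableSet_Ioo] with x hx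
  have := ContinuousMap.norm_coe_le_norm ((g : C(halfPlane h, ℂ)).comp ι
    - (f : C(halfPlane h, ℂ)).comp ι) ⟨x, Ioo_subset_Icc_self hx⟩
  have e := fun f : Hol h => value_coe f ⟨x, ofReal_mem_halfPlane hh x⟩
  simp only at e
  simpa [ι, e] using this

theorem continuous_misfit (hh : 0 < h) {fexp : ℝ → ℂ}
    (hfexp : MemLp fexp 2 (volume.restrict (Ioo (0 : ℝ) 1))) :
    Continuous (misfit fexp : Hol h → ℝ≥0∞) := by
  rw [funext (misfit_eq_enorm hh hfexp)]
  exact ((continuous_restrictLp hh).sub continuous_const).enorm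

/-- Almost everywhere agreement gives coincidence points accumulating at $1/2$, and the identity
theorem applies. -/
theorem eq_of_restrictLp_eq (hh : 0 < h) {f g : Hol h}
    (hfg : restrictLp hh f = restrictLp hh g) : f = g := by
  have hae : ∀ᵐ x : ℝ, x ∈ Ioo (0 : ℝ) 1 → value f x = value g x :=
    (ae_restrict_iff' measurableSet_Ioo).1 ((MemLp.toLp_eq_toLp_iff _ _).1 hfg)
  have hfr : ∃ᶠ z in 𝓝[≠] ((1 / 2 : ℝ) : ℂ), value f z = value g z := by
    have ht : Tendsto ((↑) : ℝ → ℂ) (𝓝[≠] (1 / 2)) (𝓝[≠] ((1 / 2 : ℝ) : ℂ)) :=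
      Complex.continuous_ofReal.continuousAt.continuousWithinAt.tendsto_nhdsWithin
        fun x hx => Complex.ofReal_injective.ne hx
    refine ht.frequently fun hev => ?_
    obtain ⟨ε, hε, hsub⟩ := Metric.eventually_nhds_iff_ball.1
      ((eventually_nhdsWithin_iff.1 hev).and
        (Ioo_mem_nhds (a := (0 : ℝ)) (b := 1) (by norm_num) (by norm_num)))
    have hpos : 0 < volume (ball (1 / 2 : ℝ) ε \ {1 / 2}) := by
      rw [measure_sdiff_null (by simp)]
      exact measure_ball_pos _ _ hε
    obtain ⟨x, hx, hx'⟩ := ((frequently_ae_iff.2 hpos.ne' :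
      ∃ᶠ x in ae volume, x ∈ ball (1 / 2 : ℝ) ε \ {1 / 2}).and_eventually hae).exists
    exact (hsub x hx.1).1 hx.2 (hx' (hsub x hx.1).2)
  have heq := ((differentiableOn_value f).analyticOnNhd
    (isOpen_halfPlane h)).eqOn_of_preconnected_of_frequently_eq
    ((differentiableOn_value g).analyticOnNhd (isOpen_halfPlane h))
    (convex_halfPlane h).isPreconnected (ofReal_mem_halfPlane hh _) hfr
  refine Subtype.ext (ContinuousMap.ext fun ω => ?_)
  rw [← value_coe, ← value_coe]
  exact heq ω.2

/-- Functions in the closed class are locally bounded in terms of their `L²(0,1)` norm. -/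
theorem norm_value_le_norm_restrictLp (hh : 0 < h) {f : Hol h} (hf : f ∈ closedClass h) {ω : ℂ}
    (hω : ω ∈ halfPlane h) :
    ‖value f ω‖ ≤ ((‖ω‖ + 1 + 2 * h) ^ 2 / ((ω.im + h) * h)) ^ 2 * ‖restrictLp hh f‖ := by
  set C := ((‖ω‖ + 1 + 2 * h) ^ 2 / ((ω.im + h) * h)) ^ 2
  have hω' : 0 < ω.im + h := by have : -h < ω.im := hω; linarith
  have hC : 0 ≤ C := by positivity
  have hpt : ∀ x ∈ Ioo (0 : ℝ) 1, ‖value f ω‖ ≤ ‖(C : ℂ) • value f x‖ := fun x hx => by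
    rw [norm_smul, Complex.norm_of_nonneg hC]
    refine (norm_value_le hf hω (ofReal_mem_halfPlane hh x)).trans ?_
    have hn : ‖ω - conj (x : ℂ) + 2 * h * Complex.I‖ ≤ ‖ω‖ + 1 + 2 * h := by
      refine (norm_add_le _ _).trans (add_le_add ((norm_sub_le _ _).trans ?_) ?_)
      · simpa [abs_of_pos hx.1] using hx.2.le
      · simp [abs_of_pos hh]
    simp only [Complex.ofReal_im, zero_add, C]
    gcongr
  -- `C` does not depend on $x$, and a constant on a probability space has $L^2$ norm equal to its
  -- modulus.
  have hle : eLpNorm (fun _ : ℝ => value f ω) 2 (volume.restrict (Ioo (0 : ℝ) 1))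
      ≤ eLpNorm (fun x : ℝ => (C : ℂ) • value f x) 2 (volume.restrict (Ioo (0 : ℝ) 1)) := by
    refine eLpNorm_mono_ae ?_
    filter_upwards [ae_restrict_mem measurableSet_Ioo] with x hx using hpt x hx
  have hle' := ENNReal.toReal_mono
    (show eLpNorm (fun x : ℝ => (C : ℂ) • value f x) 2 (volume.restrict (Ioo (0 : ℝ) 1)) ≠ ∞ from
      ((memLp_value hh f).const_smul (C : ℂ)).eLpNorm_ne_top) hle
  rw [eLpNorm_const' _ two_ne_zero ENNReal.ofNat_ne_top] at hle'
  have e : (eLpNorm (fun x : ℝ => (C : ℂ) • value f x) 2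
      (volume.restrict (Ioo (0 : ℝ) 1))).toReal = C * ‖restrictLp hh f‖ := by
    rw [restrictLp, Lp.norm_toLp]
    exact (congrArg ENNReal.toReal (eLpNorm_const_smul (C : ℂ) _ _ _)).trans
      (by simp [abs_of_nonneg hC])
  rw [e] at hle'
  simpa using hle'

theorem isCompact_closedClass_inter (hh : 0 < h) (M : ℝ) :
    IsCompact {f | f ∈ closedClass h ∧ ‖restrictLp hh f‖ ≤ M} := by
  refine isCompact_of_locally_bounded (isClosed_closure.inter
    (isClosed_le (continuous_restrictLp hh).norm continuous_const))
    (B := fun ω => ((‖ω‖ + 1 + 2 * h) ^ 2 / ((ω.im + h) * h)) ^ 2 * M) ?_ ?_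
  · refine ContinuousOn.mul (ContinuousOn.pow (ContinuousOn.div (by fun_prop)
      ((Complex.continuous_im.add continuous_const).mul continuous_const).continuousOn ?_) 2)
      continuousOn_const
    intro ω hω
    have : -h < ω.im := hω
    exact mul_ne_zero (by change ω.im + h ≠ 0; linarith) hh.ne'
  · intro f hf ω hω
    refine (norm_value_le_norm_restrictLp hh hf.1 hω).trans ?_
    have := hf.2
    gcongr

/-! ### Convexity, existence and uniqueness -/

theorem midpoint_mem_physClass {f g : Hol h} (hf : f ∈ physClass h) (hg : g ∈ physClass h) :
    (2⁻¹ : ℂ) • (f + g) ∈ physClass h := by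
  have hv : ∀ ω ∈ halfPlane h, value ((2⁻¹ : ℂ) • (f + g)) ω
      = 2⁻¹ * (value f ω + value g ω) := fun ω hω => by
    rw [value_smul _ _ hω, value_add _ _ hω]
  refine ⟨fun ω hω => ?_, fun ω hω hre => ?_, ?_⟩
  · have hω' : -conj ω ∈ halfPlane h := by simpa [halfPlane] using hω
    rw [hv _ hω, hv _ hω', ← hf.1 ω hω, ← hg.1 ω hω]
    simp [map_ofNat]
  · have h1 := hf.2.1 ω hω hre
    have h2 := hg.2.1 ω hω hre
    rw [hv _ hω, show (2⁻¹ : ℂ) = ((2⁻¹ : ℝ) : ℂ) by simp, Complex.im_ofReal_mul, Complex.add_im]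
    positivity
  · obtain ⟨A, hA, hfA⟩ := hf.2.2
    obtain ⟨B, hB, hgB⟩ := hg.2.2
    refine ⟨2⁻¹ * (A + B), by positivity, ((hfA.add hgB).const_mul_left (2⁻¹ : ℂ)).congr' ?_
      EventuallyEq.rfl⟩
    filter_upwards [mem_inf_of_right (mem_principal_self _)] with ω hω
    rw [hv _ hω]
    push_cast
    ring

theorem midpoint_mem_closedClass {f g : Hol h} (hf : f ∈ closedClass h) (hg : g ∈ closedClass h) :
    (2⁻¹ : ℂ) • (f + g) ∈ closedClass h := by
  have hc : Continuous fun p : Hol h × Hol h => (2⁻¹ : ℂ) • (p.1 + p.2) :=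
    continuous_induced_rng.2 (((continuous_subtype_val.comp continuous_fst).add
      (continuous_subtype_val.comp continuous_snd)).const_smul (2⁻¹ : ℂ))
  exact map_mem_closure₂ (f := fun f g : Hol h => (2⁻¹ : ℂ) • (f + g)) hc hf hg
    fun _ hf _ hg => midpoint_mem_physClass hf hg

theorem exists_isMinOn_misfit (hh : 0 < h) {fexp : ℝ → ℂ}
    (hfexp : MemLp fexp 2 (volume.restrict (Ioo (0 : ℝ) 1))) :
    ∃ f ∈ closedClass h, ∀ g ∈ closedClass h, misfit fexp f ≤ misfit fexp g := by
  obtain ⟨f₀, hf₀⟩ := physClass_nonempty hh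
  have hf₀' : f₀ ∈ closedClass h := subset_closure hf₀
  set e := hfexp.toLp fexp
  -- Beyond norm `M` the misfit exceeds that of `f₀`, so minimizing over the compact part suffices.
  set M := ‖restrictLp hh f₀ - e‖ + ‖e‖
  obtain ⟨f, hf, hmin⟩ := (isCompact_closedClass_inter hh M).exists_isMinOn
    ⟨f₀, hf₀', norm_le_norm_sub_add _ _⟩ (continuous_misfit hh hfexp).continuousOn
  refine ⟨f, hf.1, fun g hg => ?_⟩
  by_cases hgM : ‖restrictLp hh g‖ ≤ M
  · exact hmin ⟨hg, hgM⟩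
  · refine (hmin ⟨hf₀', norm_le_norm_sub_add _ _⟩ : misfit fexp f ≤ misfit fexp f₀).trans ?_
    rw [misfit_eq_enorm hh hfexp, misfit_eq_enorm hh hfexp, enorm_le_iff_norm_le]
    have := norm_le_norm_sub_add (restrictLp hh g) e
    push Not at hgM
    linarith

/-- By the parallelogram law, two vectors of equal norm whose midpoint is no shorter coincide. -/
theorem eq_of_isMin_misfit (hh : 0 < h) {fexp : ℝ → ℂ}
    (hfexp : MemLp fexp 2 (volume.restrict (Ioo (0 : ℝ) 1))) {f g : Hol h}
    (hf : f ∈ closedClass h) (hg : g ∈ closedClass h) (hfg : misfit fexp g = misfit fexp f)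
    (hmin : ∀ k ∈ closedClass h, misfit fexp f ≤ misfit fexp k) : g = f := by
  have hm := hmin _ (midpoint_mem_closedClass hf hg)
  simp only [misfit_eq_enorm hh hfexp] at hm hfg
  rw [enorm_le_iff_norm_le] at hm
  have hfg := congrArg ENNReal.toReal hfg
  simp only [toReal_enorm] at hfg
  set a := restrictLp hh f - hfexp.toLp fexp with ha
  set b := restrictLp hh g - hfexp.toLp fexp with hb
  have e : restrictLp hh ((2⁻¹ : ℂ) • (f + g)) - hfexp.toLp fexp = (2⁻¹ : ℂ) • (a + b) := by
    rw [restrictLp_smul, restrictLp_add, ha, hb]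
    module
  rw [e, norm_smul] at hm
  have hp := parallelogram_law_with_norm ℂ a b
  have hz : ‖a - b‖ = 0 := by
    norm_num at hm
    rw [hfg] at hp
    nlinarith [norm_nonneg a, norm_nonneg (a - b), norm_nonneg (a + b)]
  refine eq_of_restrictLp_eq hh (sub_eq_zero.1 (norm_eq_zero.1 ?_))
  rwa [ha, hb, sub_sub_sub_cancel_right, norm_sub_rev] at hz

end Permittivity

theorem theorem4p5 (h : ℝ) (hh : 0 < h) (fexp : ℝ → ℂ)
    (hfexp : MemLp fexp 2 (volume.restrict (Ioo (0 : ℝ) 1))) :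
    ∃ E : ℝ≥0∞, E ≠ ∞ ∧
      IsLeast (Permittivity.misfit fexp '' Permittivity.closedClass h) E ∧
      (∃! f : Permittivity.Hol h,
        f ∈ Permittivity.closedClass h ∧ Permittivity.misfit fexp f = E) ∧
      (Permittivity.physClass h).Nonempty ∧
      ⨅ f ∈ Permittivity.physClass h, Permittivity.misfit fexp f = E := by
  obtain ⟨f, hf, hmin⟩ := Permittivity.exists_isMinOn_misfit hh hfexp
  refine ⟨Permittivity.misfit fexp f, ?_, ⟨mem_image_of_mem _ hf, ?_⟩, ⟨f, ⟨hf, rfl⟩, ?_⟩,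
    Permittivity.physClass_nonempty hh, le_antisymm ?_ ?_⟩
  · rw [Permittivity.misfit_eq_enorm hh hfexp]
    exact enorm_ne_top
  · rintro _ ⟨g, hg, rfl⟩
    exact hmin g hg
  · rintro g ⟨hg, hgE⟩
    exact Permittivity.eq_of_isMin_misfit hh hfexp hf hg hgE hmin
  -- Being bounded below by the infimum is a closed condition, so it extends from $\mathcal{K}_h$ to
  -- the minimizer.
  · refine closure_minimal (t := {g | ⨅ f ∈ Permittivity.physClass h, Permittivity.misfit fexp f
      ≤ Permittivity.misfit fexp g}) (fun g hg => ?_)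
      (isClosed_le continuous_const (Permittivity.continuous_misfit hh hfexp)) hf
    exact iInf₂_le (f := fun g (_ : g ∈ Permittivity.physClass h) => Permittivity.misfit fexp g)
      g hg
  · exact le_iInf₂ fun g hg => hmin g (subset_closure hg)
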